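/- Let $\Gamma$ be a torsion-free, finitely generated nilpotent group. A Mal'cev basis of $\Gamma$ is a tuple $(a_1,\ldots,a_m)\in\Gamma^m$ such that every $g\in\Gamma$ can be written uniquely as $g=a_1^{x_1}\cdots a_m^{x_m}$ with $(x_1,\ldots,x_m)\in\mathbb{Z}^m$, and such that the subgroups $\Gamma_i=\langle a_i,\ldots,a_m\rangle$ form a central series of $\Gamma$, that is, $\Gamma_1=\Gamma$, $\Gamma_{m+1}=\{e\}$ and $[\Gamma,\Gamma_i]\subseteq\Gamma_{i+1}$ for $1\le i\le m$. The number $m$ is called the Hirsch length of $\Gamma$ (it does not depend on the basis), and if $m\ge 1$ the map $\alpha:\Gamma\to\mathbb{Z}$, $\alpha(a_1^{x_1}\cdots a_m^{x_m})=x_1$, is a homomorphism, called the canonical homomorphism with respect to $(a_1,\ldots,a_m)$. Theorem. Let $\Gamma$ be a torsion-free, finitely generated nilpotent group of Hirsch length at least $2$, and let $\alpha\in\operatorname{Hom}(\Gamma,\mathbb{Z})$ be the canonical homomorphism with respect to some Mal'cev basis of $\Gamma$. Let $\kappa_\alpha:\ker(\alpha)\to\Gamma$ be the inclusion. Then there is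 a class $[\sigma]\in H^2(\Gamma;\mathbb{Z})$ (trivial action on $\mathbb{Z}$) that is skinny with respect to $\alpha$, i.e. $\kappa_\alpha^*([\sigma])=0$ in $H^2(\ker(\alpha);\mathbb{Z})$, and that is non-torsion, i.e. $n[\sigma]\neq 0$ for every integer $n\neq 0$. -/

import Mathlib

universe u

namespace Malcev

section Basis

variable {Γ : Type u} [Group Γ] {m : ℕ}

/-- The ordered product `a₁ ^ x₁ ⋯ aₘ ^ xₘ`. -/
def orderedProd (a : Fin m → Γ) (x : Fin m → ℤ) : Γ :=
  (List.ofFn fun i => a i ^ x i).prod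

/-- The subgroup generated by all but the first `k` entries of `a`; it is trivial for `k ≥ m`. -/
def tailSubgroup (a : Fin m → Γ) (k : ℕ) : Subgroup Γ :=
  Subgroup.closure {g | ∃ j : Fin m, k ≤ (j : ℕ) ∧ a j = g}

/-- `a` is a Mal'cev basis of `Γ`: every element has a unique canonical form, and the subgroups
`⟨aᵢ, …, aₘ⟩` form a central series. -/
structure IsMalcevBasis (a : Fin m → Γ) : Prop where
  existsUnique_orderedProd (g : Γ) : ∃! x : Fin m → ℤ, orderedProd a x = g
  isDescendingCentralSeries : Subgroup.IsDescendingCentralSeries (tailSubgroup a)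

theorem orderedProd_update (a : Fin m → Γ) (x : Fin m → ℤ) (k : Fin m) (z : ℤ)
    (hx : ∀ i ≤ k, x i = 0) :
    orderedProd a (Function.update x k z) = a k ^ z * orderedProd a x := by
  induction m with
  | zero => exact k.elim0
  | succ m ih =>
    unfold orderedProd at ih ⊢
    rw [List.ofFn_succ, List.ofFn_succ, List.prod_cons, List.prod_cons]
    refine Fin.cases (fun hx => ?_) (fun k hx => ?_) k hx
    · simp [hx 0 le_rfl, Fin.succ_ne_zero]
    · have h0 : x 0 = 0 := hx 0 (Fin.zero_le _)
      have key := ih (fun i => a i.succ) (fun i => x i.succ) k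
        (fun i hi => hx _ (Fin.succ_le_succ_iff.2 hi))
      have hne : (0 : Fin (m + 1)) ≠ k.succ := (Fin.succ_ne_zero k).symm
      rw [Function.update_of_ne hne, h0, zpow_zero, one_mul, one_mul, ← key]
      congr 2
      funext i
      by_cases hik : i = k
      · subst hik; simp
      · rw [Function.update_of_ne hik, Function.update_of_ne (by simpa using hik)]

theorem tailSubgroup_succ_le (a : Fin m → Γ) (k : ℕ) :
    tailSubgroup a (k + 1) ≤ tailSubgroup a k :=
  Subgroup.closure_mono fun _ ⟨j, hj, h⟩ => ⟨j, by omega, h⟩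

namespace IsMalcevBasis

variable {a : Fin m → Γ}

theorem normal_tailSubgroup (ha : IsMalcevBasis a) (k : ℕ) : (tailSubgroup a k).Normal := by
  refine ⟨fun x hx g => ?_⟩
  have h := tailSubgroup_succ_le a k
    (ha.isDescendingCentralSeries.2 x⁻¹ k (inv_mem hx) g)
  have h2 := mul_mem hx h
  rw [commutatorElement_def] at h2
  simpa [mul_assoc] using h2

theorem exists_of_mem_tailSubgroup (ha : IsMalcevBasis a) {k : ℕ} (hk : k ≤ m) {g : Γ}
    (hg : g ∈ tailSubgroup a k) :
    ∃ x : Fin m → ℤ, (∀ i : Fin m, (i : ℕ) < k → x i = 0) ∧ orderedProd a x = g := by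
  induction hk using Nat.decreasingInduction generalizing g with
  | self =>
    have h : tailSubgroup a m = ⊥ := by
      rw [tailSubgroup, Subgroup.closure_eq_bot_iff]
      rintro _ ⟨j, hj, -⟩
      omega
    rw [h, Subgroup.mem_bot] at hg
    exact ⟨0, fun _ _ => rfl, by simp [orderedProd, hg]⟩
  | of_succ k hk ih =>
    have hle : tailSubgroup a k ≤ Subgroup.zpowers (a ⟨k, hk⟩) ⊔ tailSubgroup a (k + 1) := by
      rw [tailSubgroup, Subgroup.closure_le]
      rintro _ ⟨j, hj, rfl⟩
      rcases hj.eq_or_lt with h | h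
      · have : j = ⟨k, hk⟩ := Fin.ext h.symm
        subst this
        exact Subgroup.mem_sup_left (Subgroup.mem_zpowers _)
      · exact Subgroup.mem_sup_right (Subgroup.subset_closure ⟨j, h, rfl⟩)
    have := ha.normal_tailSubgroup (k + 1)
    obtain ⟨y, hy, h, hh, rfl⟩ := Subgroup.mem_sup_of_normal_right.1 (hle hg)
    obtain ⟨z, rfl⟩ := Subgroup.mem_zpowers_iff.1 hy
    obtain ⟨x, hx, rfl⟩ := ih hh
    refine ⟨Function.update x ⟨k, hk⟩ z, fun i hi => ?_, ?_⟩
    · rw [Function.update_of_ne (by rintro rfl; simp at hi)]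
      exact hx i (by omega)
    · exact orderedProd_update a x _ z fun i hi => hx i (Nat.lt_succ_of_le hi)

/-- The exponents in the canonical form of `g`. -/
noncomputable def coords (ha : IsMalcevBasis a) (g : Γ) : Fin m → ℤ :=
  (ha.existsUnique_orderedProd g).choose

theorem orderedProd_coords (ha : IsMalcevBasis a) (g : Γ) : orderedProd a (ha.coords g) = g :=
  (ha.existsUnique_orderedProd g).choose_spec.1

theorem coords_orderedProd (ha : IsMalcevBasis a) (x : Fin m → ℤ) :
    ha.coords (orderedProd a x) = x :=
  ((ha.existsUnique_orderedProd (orderedProd a x)).choose_spec.2 x rfl).symm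

theorem exists_eq_zpow_mul (ha : IsMalcevBasis a) (hm : 0 < m) (g : Γ) :
    ∃ u ∈ tailSubgroup a 1, g = a ⟨0, hm⟩ ^ ha.coords g ⟨0, hm⟩ * u := by
  set x := ha.coords g with hx
  refine ⟨orderedProd a (Function.update x ⟨0, hm⟩ 0), ?_, ?_⟩
  · refine Subgroup.list_prod_mem _ fun y hy => ?_
    obtain ⟨i, rfl⟩ := List.mem_ofFn.1 hy
    by_cases hi : i = ⟨0, hm⟩
    · subst hi; simp
    · have h1 : 1 ≤ (i : ℕ) := Nat.one_le_iff_ne_zero.2 fun h => hi (Fin.ext h)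
      have h2 : a i ∈ tailSubgroup a 1 := Subgroup.subset_closure ⟨i, h1, rfl⟩
      exact Subgroup.zpow_mem _ h2 _
  · rw [← orderedProd_update, Function.update_idem, Function.update_eq_self, hx,
      orderedProd_coords]
    intro i hi
    have : i = ⟨0, hm⟩ := Fin.ext (Nat.le_zero.1 hi)
    simp [this]

theorem coords_zpow_mul (ha : IsMalcevBasis a) (hm : 0 < m) (z : ℤ) {u : Γ}
    (hu : u ∈ tailSubgroup a 1) : ha.coords (a ⟨0, hm⟩ ^ z * u) ⟨0, hm⟩ = z := by
  obtain ⟨x, hx, rfl⟩ := ha.exists_of_mem_tailSubgroup hm hu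
  rw [← orderedProd_update a x ⟨0, hm⟩ z fun i hi => hx i (Nat.lt_succ_of_le hi),
    coords_orderedProd, Function.update_self]

/-- The canonical homomorphism `a₁ ^ x₁ ⋯ aₘ ^ xₘ ↦ x₁` with respect to a Mal'cev basis. -/
noncomputable def canonicalHom (ha : IsMalcevBasis a) (hm : 0 < m) : Γ →* Multiplicative ℤ :=
  MonoidHom.mk' (fun g => Multiplicative.ofAdd (ha.coords g ⟨0, hm⟩)) fun g h => by
    have := ha.normal_tailSubgroup 1
    obtain ⟨u, hu, hgu⟩ := ha.exists_eq_zpow_mul hm g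
    obtain ⟨v, hv, hhv⟩ := ha.exists_eq_zpow_mul hm h
    rw [← ofAdd_add]
    congr 1
    set p := ha.coords g ⟨0, hm⟩
    set q := ha.coords h ⟨0, hm⟩
    have hw : (a ⟨0, hm⟩ ^ q)⁻¹ * u * (a ⟨0, hm⟩ ^ q) * v ∈ tailSubgroup a 1 :=
      mul_mem (by simpa using this.conj_mem u hu (a ⟨0, hm⟩ ^ q)⁻¹) hv
    rw [← ha.coords_zpow_mul hm (p + q) hw, hgu, hhv, zpow_add]
    simp only [mul_assoc, mul_inv_cancel_left]

theorem canonicalHom_orderedProd (ha : IsMalcevBasis a) (hm : 0 < m) (x : Fin m → ℤ) :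
    ha.canonicalHom hm (orderedProd a x) = Multiplicative.ofAdd (x ⟨0, hm⟩) := by
  simp [canonicalHom, coords_orderedProd]

end IsMalcevBasis

end Basis

section Cohomology

/-- The integers with trivial `Γ`-action; `ULift` only moves `ℤ` to the universe of `Γ`. -/
noncomputable abbrev trivialInt (Γ : Type u) [Group Γ] : Rep.{u} (ULift.{u} ℤ) Γ :=
  Rep.trivial (ULift.{u} ℤ) Γ (ULift.{u} ℤ)

/-- The second cohomology group `H²(Γ; ℤ)`. -/
noncomputable abbrev H2 (Γ : Type u) [Group Γ] : ModuleCat.{u} (ULift.{u} ℤ) :=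
  groupCohomology (trivialInt Γ) 2

/-- The map `f^* : H²(Λ; ℤ) → H²(Γ; ℤ)` induced by a group homomorphism `f : Γ → Λ`. -/
noncomputable def H2pullback {Γ Λ : Type u} [Group Γ] [Group Λ] (f : Γ →* Λ) : H2 Λ ⟶ H2 Γ :=
  groupCohomology.map (A := trivialInt Λ) (B := trivialInt Γ) f
    (CategoryTheory.CategoryStruct.id (trivialInt Γ)) 2

/-- A class is skinny with respect to `α` if its restriction to `ker α` vanishes. -/
def IsSkinny {Γ : Type u} [Group Γ] (σ : H2 Γ) (α : Γ →* Multiplicative ℤ) : Prop :=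
  H2pullback α.ker.subtype σ = 0

end Cohomology

end Malcev

/-! With `t` the first basis element and `θ` conjugation by `t`, `Γ` is `ker α ⋊ ℤ`. Any `φ : ker α
→ ℤ` gives a class restricting to zero on `ker α`, and that class can be torsion only if some `n •
φ` with `n ≠ 0` lies in the image of `ψ ↦ ψ ∘ θ - ψ` (`exists_isSkinny_not_isOfFinAddOrder`). This
operator on `Hom(ker α, ℤ)` is nilpotent, because commutators with `t` descend the central series.
The group is torsion-free, and nonzero since `m ≥ 2`, so the operator is not rationally onto and a
suitable `φ` exists (`exists_hom_pow_ne`). -/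

namespace Malcev

/-! ### Twisted automorphisms and nilpotent operators -/

section TwistedPowers

variable {M C : Type*} [Group M] [CommGroup C]

/-- The automorphism `(x, z) ↦ (θ x, φ x * z)` of `M × C`. -/
def twistAut (θ : MulAut M) (φ : M →* C) : MulAut (M × C) where
  toFun p := (θ p.1, φ p.1 * p.2)
  invFun p := (θ⁻¹ p.1, (φ (θ⁻¹ p.1))⁻¹ * p.2)
  left_inv p := by simp
  right_inv p := by simp
  map_mul' p q := by simp [mul_mul_mul_comm]

/-- Every integer power of `twistAut θ φ` is again a twist; the twisting homomorphisms form a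
crossed homomorphism from `ℤ` with value `φ` at `1`. -/
theorem exists_crossedHom (θ : MulAut M) (φ : M →* C) :
    ∃ c : ℤ → M →* C, c 1 = φ ∧ ∀ k l x, c (k + l) x = c l x * c k ((θ ^ l) x) := by
  have key (k : ℤ) : ∃ f : M →* C, twistAut θ φ ^ k = twistAut (θ ^ k) f := by
    induction k with
    | zero => exact ⟨1, by ext p <;> simp [twistAut]⟩
    | succ k ih =>
      obtain ⟨f, hf⟩ := ih
      refine ⟨φ * f.comp θ.toMonoidHom, ?_⟩
      rw [zpow_add_one, hf, zpow_add_one]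
      ext p <;> simp [twistAut, mul_comm, mul_left_comm]
    | pred k ih =>
      obtain ⟨f, hf⟩ := ih
      refine ⟨(φ.comp (θ⁻¹).toMonoidHom)⁻¹ * f.comp (θ⁻¹).toMonoidHom, ?_⟩
      rw [zpow_sub_one, hf, zpow_sub_one]
      have hinv (p : M × C) : (twistAut θ φ)⁻¹ p = (θ⁻¹ p.1, (φ (θ⁻¹ p.1))⁻¹ * p.2) := rfl
      ext p <;> simp [hinv] <;> simp [twistAut, mul_left_comm, mul_assoc]
  choose c hc using key
  refine ⟨c, ?_, fun k l x => ?_⟩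
  · ext x
    have h := congr_arg Prod.snd (DFunLike.congr_fun (hc 1) (x, 1))
    simpa [twistAut] using h.symm
  · have h := hc (k + l)
    rw [zpow_add, hc k, hc l] at h
    have h := congr_arg Prod.snd (DFunLike.congr_fun h (x, 1))
    simpa [twistAut, mul_comm] using h.symm

/-- If `x ↦ θ x / x` is nilpotent then `θ - 1` is not surjective, even rationally, on
`Hom(M, ℤ)`, unless the latter is trivial. -/
theorem exists_hom_pow_ne (θ : MulAut M) (j : ℕ) (hθ : ∀ x, (fun x => θ x / x)^[j] x = 1)
    (χ : M →* Multiplicative ℤ) (hχ : χ ≠ 1) :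
    ∃ φ : M →* Multiplicative ℤ, ∀ n : ℕ, n ≠ 0 → ∀ ψ : M →* Multiplicative ℤ,
      ∃ x, φ x ^ n ≠ ψ (θ x / x) := by
  by_contra! H
  -- `M` may be nonabelian, so `x ↦ θ x / x` need not be a homomorphism; `H` is therefore applied
  -- pointwise, at the iterates.
  have iter (i : ℕ) : ∃ n : ℕ, n ≠ 0 ∧ ∃ ψ : M →* Multiplicative ℤ,
      ∀ x, χ x ^ n = ψ ((fun x => θ x / x)^[i] x) := by
    induction i with
    | zero => exact ⟨1, one_ne_zero, χ, fun x => by simp⟩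
    | succ i ih =>
      obtain ⟨n, hn, ψ, h⟩ := ih
      obtain ⟨n', hn', ψ', h'⟩ := H ψ
      refine ⟨n * n', mul_ne_zero hn hn', ψ', fun x => ?_⟩
      rw [pow_mul, h, h', Function.iterate_succ_apply']
  obtain ⟨n, hn, ψ, h⟩ := iter j
  refine hχ (MonoidHom.ext fun x => ?_)
  have h1 : χ x ^ n = 1 := by rw [h, hθ, map_one]
  have h2 : n • (χ x).toAdd = 0 := congr_arg Multiplicative.toAdd h1
  exact Multiplicative.toAdd.injective ((smul_eq_zero.1 h2).resolve_left hn)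

end TwistedPowers

/-! ### The skinny class attached to `φ` -/

section Extension

variable {Γ : Type u} [Group Γ]

/-- A 2-cocycle with values in the trivial module `ℤ`, from an integer-valued function. -/
noncomputable def intCocycle (f : Γ → Γ → ℤ)
    (hf : ∀ g h j, f (g * h) j + f g h = f h j + f g (h * j)) :
    groupCohomology.cocycles₂ (trivialInt Γ) :=
  ⟨fun p => ULift.up (f p.1 p.2), (groupCohomology.mem_cocycles₂_iff _).2 fun g h j =>
    ULift.down_injective (hf g h j)⟩

theorem H2pullback_intCocycle_eq_zero {Λ : Type u} [Group Λ] (i : Λ →* Γ) (f : Γ → Γ → ℤ)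
    (hf : ∀ g h j, f (g * h) j + f g h = f h j + f g (h * j))
    (h0 : ∀ x y, f (i x) (i y) = 0) :
    H2pullback i (groupCohomology.H2π (trivialInt Γ) (intCocycle f hf)) = 0 := by
  have h := groupCohomology.H2π_comp_map_apply (A := trivialInt Γ) (B := trivialInt Λ) i
    (CategoryTheory.CategoryStruct.id (trivialInt Λ)) (intCocycle f hf)
  refine h.trans ?_
  convert map_zero (groupCohomology.H2π (trivialInt Λ)).hom
  refine groupCohomology.cocycles₂_ext fun x y => ?_
  exact ULift.down_injective (h0 x y)

theorem exists_of_nsmul_H2π_intCocycle_eq_zero (f : Γ → Γ → ℤ)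
    (hf : ∀ g h j, f (g * h) j + f g h = f h j + f g (h * j)) (n : ℕ)
    (hn : n • groupCohomology.H2π (trivialInt Γ) (intCocycle f hf) = 0) :
    ∃ β : Γ → ℤ, ∀ g h, n * f g h = β h - β (g * h) + β g := by
  rw [← map_nsmul, groupCohomology.H2π_eq_zero_iff] at hn
  obtain ⟨b, hb⟩ := hn
  refine ⟨fun g => (b g).down, fun g h => ?_⟩
  have h1 := congr_arg ULift.down (congr_fun hb (g, h))
  have h2 : (n • intCocycle f hf) (g, h) = n • ULift.up (f g h) := rfl
  rw [h2] at h1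
  simpa using h1.symm

/-- The `ker α`-component of `g` with respect to the splitting of `α` given by `t`. -/
def kerPart (α : Γ →* Multiplicative ℤ) {t : Γ} (ht : α t = Multiplicative.ofAdd 1) (g : Γ) :
    α.ker :=
  ⟨g * (t ^ (α g).toAdd)⁻¹, by
    rw [MonoidHom.mem_ker, map_mul, map_inv, map_zpow, ht, ← ofAdd_zsmul]
    simp⟩

/-- Moving `t ^ α g` to the right past the kernel part of `h` conjugates that part. -/
theorem kerPart_mul (α : Γ →* Multiplicative ℤ) {t : Γ} (ht : α t = Multiplicative.ofAdd 1)
    (g h : Γ) : kerPart α ht (g * h) =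
      kerPart α ht g * (MulAut.conjNormal t ^ (α g).toAdd) (kerPart α ht h) := by
  rw [← map_zpow]
  ext
  rw [Subgroup.coe_mul, MulAut.conjNormal_apply]
  simp [kerPart, zpow_add, mul_assoc]

theorem kerPart_of_mem (α : Γ →* Multiplicative ℤ) {t : Γ} (ht : α t = Multiplicative.ofAdd 1)
    (x : α.ker) : kerPart α ht x = x := by
  ext
  simp [kerPart, MonoidHom.mem_ker.1 x.2]

/-- A homomorphism `φ : ker α → ℤ` yields the class of the central extension
`(ker α × ℤ) ⋊ ℤ` of `Γ = ker α ⋊ ℤ`; it is non-torsion if no positive multiple of `φ` has the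
form `ψ ∘ conj t - ψ`. -/
theorem exists_isSkinny_not_isOfFinAddOrder (α : Γ →* Multiplicative ℤ) {t : Γ}
    (ht : α t = Multiplicative.ofAdd 1) (φ : α.ker →* Multiplicative ℤ)
    (hφ : ∀ n : ℕ, n ≠ 0 → ∀ ψ : α.ker →* Multiplicative ℤ,
      ∃ x, φ x ^ n ≠ ψ (MulAut.conjNormal t x / x)) :
    ∃ σ : H2 Γ, IsSkinny σ α ∧ ¬ IsOfFinAddOrder σ := by
  obtain ⟨c, hc1, hc⟩ := exists_crossedHom (MulAut.conjNormal t) φ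
  have hc0 (x) : c 0 x = 1 := by simpa using hc 0 0 x
  -- The crossed relation for `c` is exactly the cocycle identity, and `c 0 = 1` makes `f` vanish
  -- when `g ∈ ker α`.
  let f (g h : Γ) : ℤ := (c (α g).toAdd (kerPart α ht h)).toAdd
  have hf (g h j : Γ) : f (g * h) j + f g h = f h j + f g (h * j) := by
    simp only [f, kerPart_mul, map_mul, toAdd_mul, hc]
    ring
  refine ⟨groupCohomology.H2π (trivialInt Γ) (intCocycle f hf),
    H2pullback_intCocycle_eq_zero _ f hf fun x y => ?_, fun hfin => ?_⟩
  · simp [f, MonoidHom.mem_ker.1 x.2, hc0]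
  obtain ⟨n, hn, hn0⟩ := isOfFinAddOrder_iff_nsmul_eq_zero.1 hfin
  obtain ⟨β, hβ⟩ := exists_of_nsmul_H2π_intCocycle_eq_zero f hf n hn0
  have hker (x : α.ker) (g : Γ) : f x g = 0 := by simp [f, MonoidHom.mem_ker.1 x.2, hc0]
  have hmul (x : α.ker) (g : Γ) : β (x * g) = β x + β g := by
    have := hβ x g
    rw [hker] at this
    linarith
  -- Comparing `β` on `t * x = (t * x * t⁻¹) * t` gives `n * φ x = β x - β (t * x * t⁻¹)`, hence the
  -- sign.
  let ψ : α.ker →* Multiplicative ℤ := MonoidHom.mk' (fun x => Multiplicative.ofAdd (- β x))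
    fun x y => by
      rw [← ofAdd_add, Subgroup.coe_mul, hmul, neg_add]
  obtain ⟨x, hx⟩ := hφ n hn.ne' ψ
  refine hx (Multiplicative.toAdd.injective ?_)
  have h1 := hβ t x
  have h2 := hmul (MulAut.conjNormal t x) t
  have h3 : f t x = (φ x).toAdd := by simp [f, ht, hc1, kerPart_of_mem]
  rw [MulAut.conjNormal_apply, inv_mul_cancel_right, ← MulAut.conjNormal_apply] at h2
  rw [map_div, toAdd_div, toAdd_pow, nsmul_eq_mul, ← h3, h1]
  simp only [ψ, MonoidHom.mk'_apply, toAdd_ofAdd]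
  linarith

end Extension

/-! ### Coordinates along the central series -/

section Basis

variable {Γ : Type u} [Group Γ] {m : ℕ} {a : Fin m → Γ}

namespace IsMalcevBasis

theorem exists_eq_zpow_mul_of_mem_tailSubgroup (ha : IsMalcevBasis a) (k : Fin m) {g : Γ}
    (hg : g ∈ tailSubgroup a k) :
    ∃ u ∈ tailSubgroup a (k + 1), g = a k ^ ha.coords g k * u := by
  obtain ⟨x, hx, rfl⟩ := ha.exists_of_mem_tailSubgroup k.2.le hg
  rw [coords_orderedProd]
  refine ⟨orderedProd a (Function.update x k 0), ?_, ?_⟩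
  · refine Subgroup.list_prod_mem _ fun y hy => ?_
    obtain ⟨i, rfl⟩ := List.mem_ofFn.1 hy
    rcases lt_trichotomy i k with hi | rfl | hi
    · simp [Function.update_of_ne hi.ne, hx i hi]
    · simp
    · have hmem : a i ∈ tailSubgroup a (k + 1) := Subgroup.subset_closure ⟨i, hi, rfl⟩
      exact Subgroup.zpow_mem _ hmem _
  · rw [← orderedProd_update, Function.update_idem, Function.update_eq_self]
    intro i hi
    rcases hi.lt_or_eq with hi | rfl
    · rw [Function.update_of_ne hi.ne, hx i hi]
    · simp

theorem coords_zpow_mul_of_mem_tailSubgroup (ha : IsMalcevBasis a) (k : Fin m) (z : ℤ) {u : Γ}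
    (hu : u ∈ tailSubgroup a (k + 1)) : ha.coords (a k ^ z * u) k = z := by
  obtain ⟨x, hx, rfl⟩ := ha.exists_of_mem_tailSubgroup k.2 hu
  rw [← orderedProd_update a x k z fun i hi => hx i (Nat.lt_succ_of_le hi),
    coords_orderedProd, Function.update_self]

theorem coords_mul_of_mem_tailSubgroup (ha : IsMalcevBasis a) (k : Fin m) {g h : Γ}
    (hg : g ∈ tailSubgroup a k) (hh : h ∈ tailSubgroup a k) :
    ha.coords (g * h) k = ha.coords g k + ha.coords h k := by
  have := ha.normal_tailSubgroup (k + 1)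
  obtain ⟨u, hu, hgu⟩ := ha.exists_eq_zpow_mul_of_mem_tailSubgroup k hg
  obtain ⟨v, hv, hhv⟩ := ha.exists_eq_zpow_mul_of_mem_tailSubgroup k hh
  set p := ha.coords g k
  set q := ha.coords h k
  -- The tail left after collecting both powers of `a k` on the left.
  have hw : (a k ^ q)⁻¹ * u * (a k ^ q) * v ∈ tailSubgroup a (k + 1) :=
    mul_mem (by simpa using this.conj_mem u hu (a k ^ q)⁻¹) hv
  rw [← ha.coords_zpow_mul_of_mem_tailSubgroup k (p + q) hw, hgu, hhv, zpow_add]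
  simp only [mul_assoc, mul_inv_cancel_left]

theorem coords_self (ha : IsMalcevBasis a) (k : Fin m) : ha.coords (a k) k = 1 := by
  simpa using ha.coords_zpow_mul_of_mem_tailSubgroup k 1 (one_mem _)

theorem ker_canonicalHom_le (ha : IsMalcevBasis a) (hm : 0 < m) :
    (ha.canonicalHom hm).ker ≤ tailSubgroup a 1 := by
  intro g hg
  obtain ⟨u, hu, hgu⟩ := ha.exists_eq_zpow_mul hm g
  have h0 : ha.coords g ⟨0, hm⟩ = 0 := congr_arg Multiplicative.toAdd hg
  rw [hgu, h0, zpow_zero, one_mul]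
  exact hu

theorem mem_ker_canonicalHom (ha : IsMalcevBasis a) (hm : 0 < m) {g : Γ}
    (hg : g ∈ tailSubgroup a 1) : g ∈ (ha.canonicalHom hm).ker := by
  have h := ha.coords_zpow_mul hm 0 hg
  rw [zpow_zero, one_mul] at h
  exact congr_arg Multiplicative.ofAdd h

theorem canonicalHom_self (ha : IsMalcevBasis a) (hm : 0 < m) :
    ha.canonicalHom hm (a ⟨0, hm⟩) = Multiplicative.ofAdd 1 :=
  congr_arg Multiplicative.ofAdd (ha.coords_self ⟨0, hm⟩)

theorem tailSubgroup_eq_bot (a : Fin m → Γ) : tailSubgroup a m = ⊥ := by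
  rw [tailSubgroup, Subgroup.closure_eq_bot_iff]
  rintro _ ⟨j, hj, -⟩
  omega

theorem exists_hom_ker_canonicalHom_ne_one (ha : IsMalcevBasis a) (hm : 0 < m) (hm' : 1 < m) :
    ∃ χ : (ha.canonicalHom hm).ker →* Multiplicative ℤ, χ ≠ 1 := by
  -- The second coordinate: additive on the kernel, and equal to 1 at the second basis element.
  refine ⟨MonoidHom.mk' (fun x => Multiplicative.ofAdd (ha.coords x ⟨1, hm'⟩)) fun x y => ?_,
    fun h => ?_⟩
  · rw [← ofAdd_add, Subgroup.coe_mul]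
    exact congr_arg _ (ha.coords_mul_of_mem_tailSubgroup ⟨1, hm'⟩
      (ha.ker_canonicalHom_le hm x.2) (ha.ker_canonicalHom_le hm y.2))
  · have hmem := ha.mem_ker_canonicalHom hm (g := a ⟨1, hm'⟩)
      (Subgroup.subset_closure ⟨_, le_rfl, rfl⟩)
    have h1 : ha.coords (a ⟨1, hm'⟩) ⟨1, hm'⟩ = 0 :=
      congr_arg Multiplicative.toAdd (DFunLike.congr_fun h ⟨_, hmem⟩)
    rw [coords_self] at h1
    exact one_ne_zero h1

theorem iterate_conjNormal_div_eq_one (ha : IsMalcevBasis a) (N : Subgroup Γ) [N.Normal]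
    (t : Γ) (x : N) : (fun x : N => MulAut.conjNormal t x / x)^[m] x = 1 := by
  have key (i : ℕ) :
      (((fun x : N => MulAut.conjNormal t x / x)^[i] x : N) : Γ) ∈ tailSubgroup a i := by
    induction i with
    | zero => rw [ha.isDescendingCentralSeries.1]; trivial
    | succ i ih =>
      rw [Function.iterate_succ_apply']
      -- The series controls `⁅x, t⁆`; its inverse `⁅t, x⁆` is `θ x / x`.
      have h := inv_mem (ha.isDescendingCentralSeries.2 _ i ih t)
      rw [commutatorElement_inv, commutatorElement_def] at h
      simpa [div_eq_mul_inv] using h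
  have h := key m
  rw [tailSubgroup_eq_bot, Subgroup.mem_bot] at h
  exact Subtype.ext h

end IsMalcevBasis

end Basis

end Malcev

theorem mainTheorem2 {Γ : Type u} [Group Γ] [Group.FG Γ] [Group.IsNilpotent Γ]
    (torsionFree : ∀ g : Γ, IsOfFinOrder g → g = 1)
    {m : ℕ} (hm : 2 ≤ m) (a : Fin m → Γ) (ha : Malcev.IsMalcevBasis a) :
    ∃ σ : Malcev.H2 Γ,
      Malcev.IsSkinny σ (ha.canonicalHom (Nat.lt_of_lt_of_le Nat.zero_lt_two hm)) ∧
        ¬ IsOfFinAddOrder σ := by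
  have hm0 : 0 < m := Nat.lt_of_lt_of_le Nat.zero_lt_two hm
  obtain ⟨χ, hχ⟩ := ha.exists_hom_ker_canonicalHom_ne_one hm0 hm
  obtain ⟨φ, hφ⟩ := Malcev.exists_hom_pow_ne (MulAut.conjNormal (a ⟨0, hm0⟩)) m
    (ha.iterate_conjNormal_div_eq_one _ _) χ hχ
  exact Malcev.exists_isSkinny_not_isOfFinAddOrder _ (ha.canonicalHom_self hm0) φ hφ
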